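/- A *multiple context-free grammar* over a finite alphabet $\Sigma$ (the *terminals*) consists of a finite set $N$ of *non-terminals*, each non-terminal $A$ having a *rank* in $\{1,2,\dots\}$, a *start* non-terminal $S\in N$ of rank $1$, and a finite set of rules of the form $$A(s_1,\dots,s_m)\leftarrow B_1(x^1_1,\dots,x^1_{k_1}),\ \dots,\ B_n(x^n_1,\dots,x^n_{k_n}),\qquad n\ge 0,$$ where $A,B_1,\dots,B_n\in N$ have ranks $m,k_1,\dots,k_n$ respectively, the $x^i_j$ are distinct variables, and $s_1,\dots,s_m$ are strings of terminals and of these variables such that each variable occurs at most once in the concatenation $s_1\cdots s_m$. If, for each $i$, the tuple $(u^i_1,\dots,u^i_{k_i})$ of words over $\Sigma$ is a value of $B_i$, then the tuple obtained from $(s_1,\dots,s_m)$ by replacing every $x^i_j$ by $u^i_j$ is a value of $A$; the values of the non-terminals are exactly the tuples obtained by applying rules in this way finitely many times (rules with $n=0$ give the initial values). The language of the grammar is the set of all $w\in\Sigma^*$ such that $(w)$ is a value of $S$. The grammar is *$k$-multiple context-free* if all its non-terminals have rank at most $k$, and a language $L\subseteq\Sigma^*$ is *multiple context-free* if it is the language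 of a $k$-multiple context-free grammar for some integer $k\ge 1$. **Corollary.** Let $\Sigma$ be a finite alphabet and let $a,b\in\Sigma$ be two distinct letters. Then the language $L_2=\{(ab^m)^n \mid m,n\ge 1\}\subseteq\Sigma^*$ is not multiple context-free. -/

import Mathlib

/-- A rule `A(s_1, …, s_m) ← B_1(x_1^1, …, x_{k_1}^1), …, B_n(x_1^n, …, x_{k_n}^n)` over the
terminals `T` and the non-terminals `N`, where `rank A` is the number of variables of `A`.
The variable `x_j^i` is the pair `⟨i, j⟩`. For `arity = 0` this is a rule `A(t_1, …, t_m) ←`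
in which all the `t_i` are words of terminals. -/
structure MCFRule (T : Type*) {N : Type*} (rank : N → ℕ) where
  /-- the non-terminal `A` on the left -/
  lhs : N
  /-- the number `n` of non-terminals on the right -/
  arity : ℕ
  /-- the non-terminals `B_1, …, B_n` on the right -/
  rhs : Fin arity → N
  /-- the strings `s_1, …, s_m` of terminals and variables -/
  out : Fin (rank lhs) → List (T ⊕ (Σ i : Fin arity, Fin (rank (rhs i))))
  /-- each variable is used at most once in the concatenation `s_1 ⋯ s_m` -/
  linear : ((List.ofFn out).flatten.filterMap Sum.getRight?).Nodup

/-- The words obtained from `s_1, …, s_m` by putting the word `u i j` in place of `x_j^i`. -/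
def MCFRule.eval {T N : Type*} {rank : N → ℕ} (r : MCFRule T rank)
    (u : ∀ i : Fin r.arity, Fin (rank (r.rhs i)) → List T) : Fin (rank r.lhs) → List T :=
  fun l => (r.out l).flatMap (Sum.elim (fun t => [t]) (fun x => u x.1 x.2))

/-- A multiple context-free grammar with terminals in `T`. -/
structure MCFGrammar (T : Type*) where
  /-- the non-terminals -/
  NT : Type
  /-- there are finitely many non-terminals -/
  finite_NT : Finite NT
  /-- the number of variables of a non-terminal -/
  rank : NT → ℕ
  rank_pos : ∀ A, 1 ≤ rank A
  /-- the rules -/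
  rules : Set (MCFRule T rank)
  /-- there are finitely many rules -/
  finite_rules : rules.Finite
  /-- the start non-terminal -/
  start : NT
  rank_start : rank start = 1

namespace MCFGrammar

/-- `G.Derives A u`: the tuple of words `u` can be obtained as a value of the non-terminal `A`
by applying rules finitely many times. -/
inductive Derives {T : Type*} (G : MCFGrammar T) : (A : G.NT) → (Fin (G.rank A) → List T) → Prop
  | apply (r : MCFRule T G.rank) (hr : r ∈ G.rules)
      (u : ∀ i : Fin r.arity, Fin (G.rank (r.rhs i)) → List T)
      (hu : ∀ i : Fin r.arity, Derives G (r.rhs i) (u i)) : Derives G r.lhs (r.eval u)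

/-- The language of `G`: all words `w` such that `S(w)` can be obtained, `S` being the start
non-terminal (which has exactly one variable). -/
def language {T : Type*} (G : MCFGrammar T) : Language T :=
  {w : List T | G.Derives G.start (fun _ => w)}

/-- A grammar is `k`-multiple context-free if every non-terminal has rank at most `k`. -/
def IsKMultiple {T : Type*} (G : MCFGrammar T) (k : ℕ) : Prop :=
  ∀ A : G.NT, G.rank A ≤ k

end MCFGrammar

/-- `L` is the language of a `k`-multiple context-free grammar. -/
def IsKMultipleContextFree {T : Type*} (k : ℕ) (L : Language T) : Prop :=
  ∃ G : MCFGrammar T, G.IsKMultiple k ∧ G.language = L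

/-- `L` is `k`-multiple context-free for some `k ≥ 1`. -/
def IsMultipleContextFree {T : Type*} (L : Language T) : Prop :=
  ∃ k : ℕ, 1 ≤ k ∧ IsKMultipleContextFree k L

/-! Only the numbers of `a` and `b` matter. Once letter order is forgotten, a multiple context-free
grammar becomes a context-free one (`toCommGrammar`), whose derivation trees can be pumped:
`exists_pumping` adds multiples of a non-zero vector bounded independently of the word. In `L₂` the
number of `a`s divides the number of `b`s. Start from counts `(n, n * m)` with `n`, `m` beyond the
bound, and pump by `(p, q)`. If `p = 0`, then `n ∣ q` forces `q = 0`; if `p > 0`, divisibility for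
all multiples forces `q = p * m` (`eq_mul_of_forall_add_dvd`), which is too large. -/

/-- A commutative context-free grammar with non-terminals `Q` and rules indexed by `R`: the rule
`r` rewrites `lhs r` to the vector `const r` and the non-terminals `rhs r i`. -/
structure CommGrammar (Q R : Type*) where
  /-- the non-terminal on the left -/
  lhs : R → Q
  /-- the number of non-terminals on the right -/
  arity : R → ℕ
  /-- the non-terminals on the right -/
  rhs : ∀ r, Fin (arity r) → Q
  /-- the Parikh vector of the terminals on the right -/
  const : R → ℕ × ℕ

/-! ### Pumping in commutative context-free grammars -/

namespace CommGrammar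

variable {Q R : Type*} (H : CommGrammar Q R)

/-- `H.Der q n v`: the vector `v` has a derivation tree with root `q` and `n` nodes. -/
inductive Der : Q → ℕ → ℕ × ℕ → Prop
  | node (r : R) (n : Fin (H.arity r) → ℕ) (v : Fin (H.arity r) → ℕ × ℕ)
      (h : ∀ i, Der (H.rhs r i) (n i) (v i)) :
      Der (H.lhs r) (1 + ∑ i, n i) (H.const r + ∑ i, v i)

/-- `H.RepFree X q n v`: as `H.Der q n v`, by a tree that has no non-terminal twice on a path
from the root and avoids the non-terminals in `X`. -/
inductive RepFree : Set Q → Q → ℕ → ℕ × ℕ → Prop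
  | node (X : Set Q) (r : R) (n : Fin (H.arity r) → ℕ) (v : Fin (H.arity r) → ℕ × ℕ)
      (hX : H.lhs r ∉ X) (h : ∀ i, RepFree (insert (H.lhs r) X) (H.rhs r i) (n i) (v i)) :
      RepFree X (H.lhs r) (1 + ∑ i, n i) (H.const r + ∑ i, v i)

/-- A derivation of size `n` from `q` that leaves one non-terminal `q'` and the vector `d`. -/
def Ctx (q q' : Q) (n : ℕ) (d : ℕ × ℕ) : Prop :=
  ∀ n' v', H.Der q' n' v' → H.Der q (n + n') (d + v')

variable {H}

theorem RepFree.der {X : Set Q} {q : Q} {n : ℕ} {v : ℕ × ℕ} (h : H.RepFree X q n v) :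
    H.Der q n v := by
  induction h with
  | node X r n v hX h ih => exact .node r n v ih

theorem Ctx.of_child {r : R} {n : Fin (H.arity r) → ℕ} {v : Fin (H.arity r) → ℕ × ℕ}
    (h : ∀ i, H.Der (H.rhs r i) (n i) (v i)) {i : Fin (H.arity r)} {q' : Q} {n₁ : ℕ} {d : ℕ × ℕ}
    (hc : H.Ctx (H.rhs r i) q' n₁ d) :
    H.Ctx (H.lhs r) q' (1 + ∑ j ∈ Finset.univ.erase i, n j + n₁)
      (H.const r + ∑ j ∈ Finset.univ.erase i, v j + d) := by
  intro n' v' h'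
  have key := Der.node (H := H) r (Function.update n i (n₁ + n')) (Function.update v i (d + v'))
    (fun j => by
      by_cases hj : j = i
      · subst hj
        simpa using hc _ _ h'
      · simpa [hj] using h j)
  rw [← Finset.add_sum_erase _ _ (Finset.mem_univ i),
    ← Finset.add_sum_erase (Finset.univ) (Function.update v i (d + v')) (Finset.mem_univ i),
    Finset.sum_congr rfl (fun j hj => Function.update_of_ne (Finset.ne_of_mem_erase hj) _ n),
    Finset.sum_congr rfl (fun j hj => Function.update_of_ne (Finset.ne_of_mem_erase hj) _ v),
    Function.update_self, Function.update_self] at key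
  convert key using 1
  · ring
  · abel

/-- Either `y` does not occur in the tree, or the tree can be cut at an occurrence of `y`. -/
theorem RepFree.insert_or_ctx {X : Set Q} {q : Q} {n : ℕ} {v : ℕ × ℕ} (h : H.RepFree X q n v)
    (y : Q) :
    H.RepFree (insert y X) q n v ∨ ∃ n₁ d n₂ v₂, H.Ctx q y n₁ d ∧ H.Der y n₂ v₂ ∧
      n = n₁ + n₂ ∧ v = d + v₂ := by
  induction h with
  | node X r n v hX h ih =>
    by_cases hy : H.lhs r = y
    · right
      refine ⟨0, 0, _, _, ?_, hy ▸ Der.node r n v fun i => (h i).der, by simp, by simp⟩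
      intro n' v' h'
      simpa [hy] using h'
    · by_cases hall : ∀ i, H.RepFree (insert y (insert (H.lhs r) X)) (H.rhs r i) (n i) (v i)
      · left
        refine .node _ r n v (by simp [hy, hX]) fun i => ?_
        rw [Set.insert_comm]
        exact hall i
      · right
        push Not at hall
        obtain ⟨i, hi⟩ := hall
        obtain ⟨n₁, d, n₂, v₂, hc, hd, hn, hv⟩ := (ih i).resolve_left hi
        refine ⟨_, _, n₂, v₂, Ctx.of_child (fun j => (h j).der) hc, hd, ?_, ?_⟩
        · rw [← Finset.add_sum_erase _ _ (Finset.mem_univ i), hn]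
          ring
        · rw [← Finset.add_sum_erase _ _ (Finset.mem_univ i), hv]
          abel

variable (H) in
theorem exists_node_bound [Finite R] (C : ℕ × ℕ) :
    ∃ C' : ℕ × ℕ, ∀ r (v : Fin (H.arity r) → ℕ × ℕ), (∀ i, v i ≤ C) →
      H.const r + ∑ i, v i ≤ C' := by
  obtain ⟨_⟩ := nonempty_fintype R
  refine ⟨∑ r, (H.const r + H.arity r • C), fun r v hv => ?_⟩
  calc H.const r + ∑ i, v i ≤ H.const r + H.arity r • C := by
        gcongr
        simpa using Finset.sum_le_sum (s := Finset.univ) fun i _ => hv i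
    _ ≤ _ := Finset.single_le_sum (f := fun r => H.const r + H.arity r • C)
        (fun _ _ => zero_le) (Finset.mem_univ r)

variable (H) in
-- Each step down a path uses up one of the at most `k` permitted non-terminals, so the depth is
-- bounded.
theorem exists_repFree_bound [Finite Q] [Finite R] (k : ℕ) :
    ∃ C : ℕ × ℕ, ∀ X : Set Q, Xᶜ.ncard ≤ k → ∀ q n v, H.RepFree X q n v → v ≤ C := by
  induction k with
  | zero =>
    refine ⟨0, fun X hX q n v h => ?_⟩
    obtain ⟨X, r, n, v, hr, h⟩ := h
    rw [Nat.le_zero, Set.ncard_eq_zero] at hX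
    exact absurd (show H.lhs r ∈ Xᶜ from hr) (by simp [hX])
  | succ k ih =>
    obtain ⟨C, hC⟩ := ih
    obtain ⟨C', hC'⟩ := H.exists_node_bound C
    refine ⟨C', fun X hX q n v h => ?_⟩
    obtain ⟨X, r, n, v, hr, h⟩ := h
    refine hC' r v fun i => hC _ ?_ _ _ _ (h i)
    have : (insert (H.lhs r) X)ᶜ = Xᶜ \ {H.lhs r} := by
      ext; simp [not_or, and_comm]
    have h2 := Set.ncard_sdiff_singleton_add_one (s := Xᶜ) (a := H.lhs r) hr
    rw [this]
    omega

variable (H) in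
-- Take a lowest node whose subtree is not repetition-free. Its non-terminal recurs below it, and
-- the context in between is small because the subtrees of its children are repetition-free.
theorem exists_pump_or_bound [Finite Q] [Finite R] :
    ∃ C : ℕ × ℕ, ∀ q n v, H.Der q n v → v ≤ C ∨
      ∃ q' n₁ d n₀ p n₂ v₂, 0 < n₀ ∧ p ≤ C ∧ H.Ctx q q' n₁ d ∧ H.Ctx q' q' n₀ p ∧
        H.Der q' n₂ v₂ ∧ n = n₁ + n₀ + n₂ ∧ v = d + p + v₂ := by
  obtain ⟨C, hC⟩ := H.exists_repFree_bound (∅ᶜ : Set Q).ncard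
  obtain ⟨C', hC'⟩ := H.exists_node_bound C
  refine ⟨C ⊔ C', fun q n v h => ?_⟩
  suffices hs : H.RepFree ∅ q n v ∨
      ∃ q' n₁ d n₀ p n₂ v₂, 0 < n₀ ∧ p ≤ C' ∧ H.Ctx q q' n₁ d ∧ H.Ctx q' q' n₀ p ∧
        H.Der q' n₂ v₂ ∧ n = n₁ + n₀ + n₂ ∧ v = d + p + v₂ by
    rcases hs with hs | ⟨q', n₁, d, n₀, p, n₂, v₂, h0, hp, hs⟩
    · exact .inl ((hC _ le_rfl _ _ _ hs).trans le_sup_left)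
    · exact .inr ⟨q', n₁, d, n₀, p, n₂, v₂, h0, hp.trans le_sup_right, hs⟩
  induction h with
  | node r n v h ih =>
    by_cases hall : ∀ i, H.RepFree ∅ (H.rhs r i) (n i) (v i)
    · by_cases hall' : ∀ i, H.RepFree (insert (H.lhs r) ∅) (H.rhs r i) (n i) (v i)
      · exact .inl (.node _ r n v (by simp) hall')
      · push Not at hall'
        obtain ⟨i, hi⟩ := hall'
        obtain ⟨n₁, d, n₂, v₂, hc, hd, hn, hv⟩ := ((hall i).insert_or_ctx _).resolve_left hi
        have hv' : H.const r + ∑ j, v j =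
            H.const r + ∑ j ∈ Finset.univ.erase i, v j + d + v₂ := by
          rw [← Finset.add_sum_erase _ _ (Finset.mem_univ i), hv]
          abel
        refine .inr ⟨H.lhs r, 0, 0, _, _, n₂, v₂, ?_, ?_, ?_, Ctx.of_child h hc, hd, ?_, ?_⟩
        · omega
        · refine le_trans ?_ (hC' r v fun i => hC _ le_rfl _ _ _ (hall i))
          rw [hv']
          exact le_self_add
        · intro n' v' h'
          simpa using h'
        · rw [← Finset.add_sum_erase _ _ (Finset.mem_univ i), hn]
          ring
        · rw [hv', zero_add]
    · push Not at hall
      obtain ⟨i, hi⟩ := hall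
      obtain ⟨q', n₁, d, n₀, p, n₂, v₂, h0, hp, hc, hc', hd, hn, hv⟩ := (ih i).resolve_left hi
      refine .inr ⟨q', _, _, n₀, p, n₂, v₂, h0, hp, Ctx.of_child h hc, hc', hd, ?_, ?_⟩
      · rw [← Finset.add_sum_erase _ _ (Finset.mem_univ i), hn]
        ring
      · rw [← Finset.add_sum_erase _ _ (Finset.mem_univ i), hv]
        abel

theorem Ctx.iterate {q : Q} {n : ℕ} {p : ℕ × ℕ} (h : H.Ctx q q n p) (k : ℕ) :
    H.Ctx q q (k * n) (k • p) := by
  induction k with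
  | zero => intro n' v' h'; simpa using h'
  | succ k ih =>
    intro n' v' h'
    convert h _ _ (ih _ _ h') using 1
    · ring
    · rw [succ_nsmul']; abel

/-- Pumping in a commutative grammar, with a bound on the pumped vector. -/
theorem exists_pumping [Finite Q] [Finite R] (H : CommGrammar Q R) :
    ∃ C : ℕ × ℕ, ∀ q n v, H.Der q n v → ¬ v ≤ C →
      ∃ p, p ≠ 0 ∧ p ≤ C ∧ ∀ k : ℕ, ∃ n', H.Der q n' (v + k • p) := by
  obtain ⟨C, hC⟩ := H.exists_pump_or_bound
  refine ⟨C, fun q n v h hv => ?_⟩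
  induction n using Nat.strong_induction_on with
  | _ n ih =>
    obtain ⟨q', n₁, d, n₀, p, n₂, v₂, h0, hp, hc, hc', hd, hn, hv'⟩ := (hC q n v h).resolve_left hv
    -- If `p = 0`, removing the pump keeps the vector and shrinks the tree, as `0 < n₀`; hence the
    -- induction on size.
    by_cases hp0 : p = 0
    · refine ih (n₁ + n₂) (by omega) ?_
      have := hc _ _ hd
      rwa [hv', hp0, add_zero]
    -- `k + 1` copies, since `v` already contains one `p`.
    · refine ⟨p, hp0, hp, fun k => ⟨n₁ + ((k + 1) * n₀ + n₂), ?_⟩⟩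
      convert hc _ _ (hc'.iterate (k + 1) _ _ hd) using 1
      rw [hv', succ_nsmul]
      abel

end CommGrammar

/-! ### Letter counts of multiple context-free languages -/

section Parikh

open Classical in
/-- The numbers of occurrences of `a` and `b` in a word. -/
noncomputable def letterCounts {T : Type*} (a b : T) (w : List T) : ℕ × ℕ :=
  (w.count a, w.count b)

variable {T : Type*} (a b : T)

theorem letterCounts_nil : letterCounts a b [] = 0 := by simp [letterCounts]

theorem letterCounts_append (u v : List T) :
    letterCounts a b (u ++ v) = letterCounts a b u + letterCounts a b v := by
  simp [letterCounts]

namespace MCFRule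

variable {N : Type*} {rank : N → ℕ} (r : MCFRule T rank)

/-- The variables of the `i`-th non-terminal on the right that occur in the strings indexed
by `S`. -/
def usedVars (S : Set (Fin (rank r.lhs))) (i : Fin r.arity) : Set (Fin (rank (r.rhs i))) :=
  {j | ∃ l ∈ S, Sum.inr ⟨i, j⟩ ∈ r.out l}

/-- The letter counts of the terminals in the strings indexed by `S`. -/
noncomputable def constCounts (S : Set (Fin (rank r.lhs))) : ℕ × ℕ :=
  letterCounts a b <| open Classical in
    ((List.finRange _).filter (· ∈ S)).flatMap fun l => (r.out l).filterMap Sum.getLeft?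

end MCFRule

theorem letterCounts_flatMap_elim {X : Type*} [Fintype X] [DecidableEq X] (f : X → List T) (s : List (T ⊕ X)) :
    letterCounts a b (s.flatMap (Sum.elim (fun t => [t]) f)) =
      letterCounts a b (s.filterMap Sum.getLeft?) +
        ∑ x, (s.filterMap Sum.getRight?).count x • letterCounts a b (f x) := by
  induction s with
  | nil => simp [letterCounts_nil]
  | cons y s ih =>
    rw [List.flatMap_cons, letterCounts_append, ih]
    cases y with
    | inl t =>
      have : letterCounts a b (List.filterMap Sum.getLeft? (Sum.inl t :: s)) =
          letterCounts a b [t] + letterCounts a b (List.filterMap Sum.getLeft? s) := by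
        rw [← letterCounts_append]; simp
      rw [this, List.filterMap_cons, Sum.getRight?_inl, add_assoc]
      rfl
    | inr x =>
      simp only [List.filterMap_cons, Sum.getLeft?_inr, Sum.getRight?_inr, List.count_cons, add_smul,
        Finset.sum_add_distrib, beq_iff_eq, ite_smul, one_smul, zero_smul, Finset.sum_ite_eq,
        Finset.mem_univ, if_true, Sum.elim_inr]
      abel

namespace MCFRule

variable {N : Type*} {rank : N → ℕ} (r : MCFRule T rank)

open Classical in
theorem sum_count_out_le_one (x : Σ i : Fin r.arity, Fin (rank (r.rhs i))) :
    ∑ l, ((r.out l).filterMap Sum.getRight?).count x ≤ 1 := by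
  have h := List.nodup_iff_count_le_one.1 r.linear x
  rw [List.filterMap_flatten, List.count_flatten, List.map_ofFn, List.map_ofFn, List.sum_ofFn] at h
  exact h

open Classical in
-- By linearity no variable is duplicated, only possibly dropped, so a set of surviving components
-- is all the commutative grammar needs to remember.
theorem sum_count_out (S : Set (Fin (rank r.lhs)))
    (x : Σ i : Fin r.arity, Fin (rank (r.rhs i))) :
    ∑ l with l ∈ S, ((r.out l).filterMap Sum.getRight?).count x = if x.2 ∈ r.usedVars S x.1 then 1 else 0 := by
  split_ifs with h
  · apply le_antisymm
    · exact (Finset.sum_le_sum_of_subset (Finset.filter_subset _ _)).trans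
        (r.sum_count_out_le_one x)
    · obtain ⟨l, hl, hx⟩ := h
      exact (List.count_pos_iff.2 (by simpa using hx)).trans_le
        (Finset.single_le_sum (f := fun l => ((r.out l).filterMap Sum.getRight?).count x)
          (fun _ _ => Nat.zero_le _) (by simpa using hl))
  · refine Finset.sum_eq_zero fun l hl => List.count_eq_zero.2 fun hx => h ⟨l, ?_, ?_⟩
    · simpa using hl
    · simpa using hx

open Classical in
theorem sum_letterCounts_eval (S : Set (Fin (rank r.lhs)))
    (u : ∀ i : Fin r.arity, Fin (rank (r.rhs i)) → List T) :
    ∑ l with l ∈ S, letterCounts a b (r.eval u l) =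
      r.constCounts a b S + ∑ i, ∑ j with j ∈ r.usedVars S i, letterCounts a b (u i j) := by
  have hconst : r.constCounts a b S =
      ∑ l with l ∈ S, letterCounts a b ((r.out l).filterMap Sum.getLeft?) := by
    have hflat : ∀ (L : List (Fin (rank r.lhs))) (f : Fin (rank r.lhs) → List T),
        letterCounts a b (L.flatMap f) = (L.map fun l => letterCounts a b (f l)).sum := by
      intro L f
      induction L with
      | nil => simp [letterCounts_nil]
      | cons l L ih => simp [letterCounts_append, ih]
    rw [constCounts, hflat, ← List.sum_toFinset _ ((List.nodup_finRange _).filter _)]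
    refine Finset.sum_congr ?_ fun _ _ => rfl
    ext l
    simp
  simp only [eval, letterCounts_flatMap_elim, Finset.sum_add_distrib]
  rw [hconst, Finset.sum_comm]
  simp only [← Finset.sum_smul, sum_count_out]
  rw [Fintype.sum_sigma]
  simp only [ite_smul, one_smul, zero_smul, Finset.sum_filter]

end MCFRule

namespace MCFGrammar

variable (G : MCFGrammar T)

/-- The commutative grammar of the letter counts of `G`. The non-terminal `(A, S)` stands for the
concatenation of the components in `S` of a value of `A`. -/
noncomputable def toCommGrammar :
    CommGrammar (Σ A : G.NT, Set (Fin (G.rank A)))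
      (Σ r : G.rules, Set (Fin (G.rank r.1.lhs))) where
  lhs r := ⟨r.1.1.lhs, r.2⟩
  arity r := r.1.1.arity
  rhs r i := ⟨r.1.1.rhs i, r.1.1.usedVars r.2 i⟩
  const r := r.1.1.constCounts a b r.2

variable {G}

open Classical in
theorem Derives.toCommGrammar_der {A : G.NT} {u : Fin (G.rank A) → List T} (h : G.Derives A u)
    (S : Set (Fin (G.rank A))) :
    ∃ n, (G.toCommGrammar a b).Der ⟨A, S⟩ n (∑ l with l ∈ S, letterCounts a b (u l)) := by
  induction h with
  | apply r hr u hu ih =>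
    choose n hn using fun i => ih i (r.usedVars S i)
    rw [r.sum_letterCounts_eval]
    exact ⟨_, .node (H := G.toCommGrammar a b) ⟨⟨r, hr⟩, S⟩ n _ hn⟩

open Classical in
theorem exists_derives_of_toCommGrammar_der {q : Σ A : G.NT, Set (Fin (G.rank A))} {n : ℕ}
    {v : ℕ × ℕ} (h : (G.toCommGrammar a b).Der q n v) :
    ∃ u, G.Derives q.1 u ∧ ∑ l with l ∈ q.2, letterCounts a b (u l) = v := by
  induction h with
  | node r n v h ih =>
    choose u hu hv using ih
    refine ⟨_, .apply r.1.1 r.1.2 u hu, ?_⟩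
    refine (r.1.1.sum_letterCounts_eval a b r.2 u).trans ?_
    exact congrArg _ (Finset.sum_congr rfl fun i _ => hv i)

theorem mem_image_letterCounts_iff (v : ℕ × ℕ) :
    (∃ w ∈ G.language, letterCounts a b w = v) ↔
      ∃ n, (G.toCommGrammar a b).Der ⟨G.start, Set.univ⟩ n v := by
  constructor
  · rintro ⟨w, hw, rfl⟩
    obtain ⟨n, hn⟩ := Derives.toCommGrammar_der a b (show G.Derives G.start fun _ => w from hw)
      Set.univ
    exact ⟨n, by simpa [G.rank_start] using hn⟩
  · rintro ⟨n, hn⟩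
    obtain ⟨u, hu, rfl⟩ := exists_derives_of_toCommGrammar_der a b hn
    have hsub : Subsingleton (Fin (G.rank G.start)) := by
      rw [G.rank_start]; infer_instance
    have hu' : u = fun _ => u ⟨0, G.rank_pos _⟩ := funext fun l => congrArg u (hsub.elim _ _)
    refine ⟨u ⟨0, G.rank_pos _⟩, hu' ▸ hu, ?_⟩
    rw [hu']
    simp [G.rank_start]

end MCFGrammar

/-- Every letter count vector of a multiple context-free language that is not small can be pumped
by a small non-zero vector. -/
theorem IsMultipleContextFree.exists_letterCounts_pumping {L : Language T}
    (hL : IsMultipleContextFree L) :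
    ∃ C : ℕ × ℕ, ∀ w ∈ L, ¬ letterCounts a b w ≤ C →
      ∃ p, p ≠ 0 ∧ p ≤ C ∧ ∀ k : ℕ, ∃ w' ∈ L,
        letterCounts a b w' = letterCounts a b w + k • p := by
  obtain ⟨-, -, G, -, rfl⟩ := hL
  have := G.finite_NT
  have := G.finite_rules.to_subtype
  obtain ⟨C, hC⟩ := (G.toCommGrammar a b).exists_pumping
  refine ⟨C, fun w hw hwC => ?_⟩
  obtain ⟨n, hn⟩ := (MCFGrammar.mem_image_letterCounts_iff a b _).1 ⟨w, hw, rfl⟩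
  obtain ⟨p, hp0, hpC, hp⟩ := hC _ _ _ hn hwC
  exact ⟨p, hp0, hpC, fun k => (MCFGrammar.mem_image_letterCounts_iff a b _).2 (hp k)⟩

end Parikh

/-! ### Divisibility and the contradiction -/

theorem letterCounts_flatten_replicate {T : Type*} {a b : T} (hab : a ≠ b) (m n : ℕ) :
    letterCounts a b (List.replicate n (a :: List.replicate m b)).flatten = (n, n * m) := by
  simp [letterCounts, List.count_flatten, List.count_replicate, hab, hab.symm]

/-- Modulo `x + k * p` one has `k * p ≡ -x`, so multiplying the dividend by `p` shows that the fixed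
number `x * (q - p * m)` has arbitrarily large divisors. -/
theorem eq_mul_of_forall_add_dvd {x m p q : ℕ} (hp : 0 < p)
    (h : ∀ k : ℕ, x + k * p ∣ x * m + k * q) (hx : 0 < x) : q = p * m := by
  set k := (x * ((q : ℤ) - p * m)).natAbs + 1 with hk
  have h1 : ((x + k * p : ℕ) : ℤ) ∣ x * ((q : ℤ) - p * m) := by
    have h2 : ((x + k * p : ℕ) : ℤ) ∣ ((x * m + k * q : ℕ) : ℤ) := Int.natCast_dvd_natCast.2 (h k)
    obtain ⟨c, hc⟩ := h2
    refine ⟨q - p * c, ?_⟩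
    push_cast at hc ⊢
    linear_combination (-(p : ℤ)) * hc
  have h3 : (x * ((q : ℤ) - p * m)).natAbs = 0 := by
    refine Nat.eq_zero_of_dvd_of_lt (Int.natCast_dvd.1 h1) ?_
    nlinarith
  rw [Int.natAbs_eq_zero, mul_eq_zero] at h3
  rcases h3 with h3 | h3
  · omega
  · exact_mod_cast sub_eq_zero.1 h3

theorem corollary5p3 {T : Type*} [Finite T] (a b : T) (hab : a ≠ b) :
    ¬ IsMultipleContextFree
      ({w : List T | ∃ m n : ℕ, 1 ≤ m ∧ 1 ≤ n ∧
        w = (List.replicate n (a :: List.replicate m b)).flatten} : Language T) := by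
  intro hL
  obtain ⟨⟨C₁, C₂⟩, hC⟩ := hL.exists_letterCounts_pumping a b
  obtain ⟨⟨p, q⟩, hp0, hpC, hp⟩ := hC _
    -- `n > C₁` makes the word pumpable, `n > C₂` settles `p = 0`, and `m > C₂` settles `p > 0`.
    ⟨C₂ + 1, C₁ + C₂ + 1, by omega, by omega, rfl⟩ (by
      rw [letterCounts_flatten_replicate hab, Prod.mk_le_mk]
      omega)
  rw [Prod.mk_le_mk] at hpC
  have hdvd : ∀ k : ℕ, C₁ + C₂ + 1 + k * p ∣ (C₁ + C₂ + 1) * (C₂ + 1) + k * q := by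
    intro k
    obtain ⟨w, ⟨m, n, -, -, rfl⟩, hw⟩ := hp k
    rw [letterCounts_flatten_replicate hab, letterCounts_flatten_replicate hab] at hw
    simp only [Prod.smul_mk, Prod.mk_add_mk, Prod.mk.injEq, smul_eq_mul] at hw
    rw [← hw.1, ← hw.2]
    exact dvd_mul_right _ _
  rcases Nat.eq_zero_or_pos p with rfl | hpos
  · have h1 := hdvd 1
    rw [mul_zero, add_zero, one_mul, Nat.dvd_add_right (dvd_mul_right _ _)] at h1
    have hq := Nat.eq_zero_of_dvd_of_lt h1 (by omega)
    exact hp0 (by rw [hq]; rfl)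
  · have h2 := eq_mul_of_forall_add_dvd hpos hdvd (by omega)
    nlinarith [hpC.2]
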